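/- **Setting.** Let $g:(0,\infty)\to\mathbb R$ be smooth and operator convex with $g(1)=0$ and $g''(1)=1$, and let $f(x)=\frac{(x-1)^2}{g(x)+x\,g(x^{-1})}$ for $x\neq 1$, $f(1)=1$. Let $\nu_0,\nu_1$ be the finite positive measures on $[0,1]$ of the integral representation of $g$, i.e. for some $a\in\mathbb R$ and all $x>0$, $$g(x)=a(x-1)+\int_0^1 d\nu_0(s)\,\frac{(x-1)^2}{x+s}+\int_0^1 d\nu_1(s)\,\frac{(x-1)^2}{1+sx},$$ and put $N_g:=\nu_0+\nu_1$. (If $\nu_g$ denotes the measure of the representation of $g$, then $d\nu_0(s)=d\nu_g(s)$ and $d\nu_1(s)=d\nu_g(s^{-1})/s$. Integrals $\int_0^1$ are over the closed interval.) For a $d\times d$ complex matrix $\rho$ let $\mathbb L_\rho[X]=\rho X$, $\mathbb R_\rho[X]=X\rho$. For positive definite $\rho$ let $\mathbb J_f|_\rho=\mathbb R_\rho\, f(\mathbb L_\rho\mathbb R_\rho^{-1})$, and define the Fisher information $\mathcal F_{f,\rho}(X)=\mathrm{Tr}\big(X\,\mathbb J_f|_\rho^{-1}[X]\big)$. Let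 $(\Phi_t)_{t\ge 0}$ be a divisible evolution on $d\times d$ matrices: completely positive maps depending smoothly on $t$, with linear intermediate maps $\Phi_{t,s}$ (not necessarily positive) such that $\Phi_t=\Phi_{t,s}\circ\Phi_s$ for $0\le s\le t$. Suppose that its generator $\mathcal L_t=\lim_{\varepsilon\downarrow0}(\Phi_{t+\varepsilon,t}-\mathrm{id})/\varepsilon$ exists for every $t\ge 0$ and has the time-dependent GKLS form $$\mathcal L_t[\rho]=-i[H(t),\rho]+\sum_\alpha\lambda_\alpha(t)\Big(A_\alpha(t)\rho A_\alpha(t)^\dagger-\tfrac12\{A_\alpha(t)^\dagger A_\alpha(t),\rho\}\Big),$$ where $\alpha$ runs over a finite index set, $H(t)$ is Hermitian, the rates $\lambda_\alpha(t)$ are real (of any sign) and the jump operators $A_\alpha(t)$ are $d\times d$ matrices (in particular they may be the traceless Hilbert–Schmidt orthonormal ones of the canonical form, $\alpha=1,\dots,d^2-1$). Let $\pi$ be a density matrix, $\delta\rho$ a traceless Hermitian matrix, and write $\pi_t=\Phi_t(\pi)$, $\delta\rho_t=\Phi_t(\delta\rho)$, $\mathcal F_{f,t}=\mathcal F_{f,\pi_t}(\delta\rho_t)$.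 **Theorem.** For every $t\ge0$ such that $\pi_t$ is positive definite, $\mathcal F_{f,t}$ is differentiable at $t$ (from the right if $t=0$) and $$\mathcal F'_{f,t}=\sum_\alpha\lambda_\alpha(t)\,\mathcal I^f_\alpha(t),$$ where, with $B_s(t)=(\mathbb L_{\pi_t}+s\,\mathbb R_{\pi_t})^{-1}[\delta\rho_t]$, $$\mathcal I^f_\alpha(t)=-2\int_0^1 dN_g(s)\Big(\mathrm{Tr}\big(\pi_t[A_\alpha(t),B_s(t)^\dagger]^\dagger[A_\alpha(t),B_s(t)^\dagger]\big)+s\,\mathrm{Tr}\big(\pi_t[A_\alpha(t),B_s(t)]^\dagger[A_\alpha(t),B_s(t)]\big)\Big).$$ For each $\alpha$ the integrand is integrable with respect to $N_g$ and is real and nonnegative for every $s\in[0,1]$; hence each current $\mathcal I^f_\alpha(t)$ is real and nonpositive. -/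

import Mathlib

open MeasureTheory Set Filter
open scoped Topology ContDiff Matrix ComplexOrder Kronecker

namespace FisherFlow

/-! ### Contrast functions and the associated functions and measures -/

/-- Operator convexity of `g` on `(0, ∞)`: for matrices of every size `m`, with `g` applied
through the functional calculus,
`g (θ A + (1 - θ) B) ≤ θ g A + (1 - θ) g B` in the Loewner order. -/
def OperatorConvex (g : ℝ → ℝ) : Prop :=
  ∀ (m : ℕ) (A B : Matrix (Fin m) (Fin m) ℂ), A.PosDef → B.PosDef →
    ∀ θ : ℝ, 0 ≤ θ → θ ≤ 1 →
      (θ • cfc g A + (1 - θ) • cfc g B - cfc g (θ • A + (1 - θ) • B)).PosSemidef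

/-- The function `g : (0, ∞) → ℝ` defines a (normalised) contrast function: it is smooth and
operator convex, `g 1 = 0` and `g'' 1 = 1`. Values of `g` outside `(0, ∞)` play no role. -/
structure IsContrastFunction (g : ℝ → ℝ) : Prop where
  smooth : ContDiffOn ℝ ∞ g (Ioi 0)
  operatorConvex : OperatorConvex g
  map_one : g 1 = 0
  normalised : iteratedDeriv 2 g 1 = 1

/-- The function `f x = (x - 1)² / (g x + x g (x⁻¹))` attached to a contrast function `g`; at the
removable singularity `x = 1` it has the value `1 / g'' 1 = 1`. -/
noncomputable def standardFunction (g : ℝ → ℝ) (x : ℝ) : ℝ :=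
  if x = 1 then 1 else (x - 1) ^ 2 / (g x + x * g x⁻¹)

/-- `ν₀` and `ν₁` are the measures of the integral representation of `g`, that is, up to a
linear term,
`g x = ∫₀¹ (x - 1)² / (x + s) dν₀(s) + ∫₀¹ (x - 1)² / (1 + s x) dν₁(s)`.
With `ν` the measure of the representation of `g`, `ν₀` stands for `dν(s)` on `[0, 1]` and `ν₁`
for `dν(s⁻¹) / s` on `[0, 1]` (its atom at `0` is the mass of `ν` at infinity). -/
def IsIntegralRepresentation (g : ℝ → ℝ) (ν₀ ν₁ : Measure ℝ) : Prop :=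
  ∃ a : ℝ, ∀ x : ℝ, 0 < x →
    g x = a * (x - 1) + (∫ s in Icc (0 : ℝ) 1, (x - 1) ^ 2 / (x + s) ∂ν₀)
      + ∫ s in Icc (0 : ℝ) 1, (x - 1) ^ 2 / (1 + s * x) ∂ν₁

/-! ### Superoperators and the quantum Fisher information -/

variable {d : ℕ}

/-- Superoperators: linear maps on `d × d` complex matrices. -/
abbrev SuperOp (d : ℕ) : Type :=
  Module.End ℂ (Matrix (Fin d) (Fin d) ℂ)

/-- Left multiplication `X ↦ ρ X`. -/
noncomputable def leftMul (ρ : Matrix (Fin d) (Fin d) ℂ) : SuperOp d :=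
  LinearMap.mulLeft ℂ ρ

/-- Right multiplication `X ↦ X ρ`. -/
noncomputable def rightMul (ρ : Matrix (Fin d) (Fin d) ℂ) : SuperOp d :=
  LinearMap.mulRight ℂ ρ

/-- The function `f` of a superoperator `T` that is self-adjoint for the Hilbert-Schmidt scalar
product, through the functional calculus of the matrix of `T` in the orthonormal basis of
matrix units. -/
noncomputable def superFun (f : ℝ → ℝ) (T : SuperOp d) : SuperOp d :=
  Matrix.toLin (Matrix.stdBasis ℂ (Fin d) (Fin d)) (Matrix.stdBasis ℂ (Fin d) (Fin d))
    (cfc f (LinearMap.toMatrix (Matrix.stdBasis ℂ (Fin d) (Fin d))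
      (Matrix.stdBasis ℂ (Fin d) (Fin d)) T))

/-- The quantum Fisher operator `J_f|_ρ = R_ρ f(L_ρ R_ρ⁻¹)`. -/
noncomputable def fisherOp (f : ℝ → ℝ) (ρ : Matrix (Fin d) (Fin d) ℂ) : SuperOp d :=
  rightMul ρ * superFun f (leftMul ρ * Ring.inverse (rightMul ρ))

/-- The quantum Fisher information `Tr (X J_f⁻¹|_ρ [X])` at `ρ` in the direction `X`. -/
noncomputable def fisherInfo (f : ℝ → ℝ) (ρ X : Matrix (Fin d) (Fin d) ℂ) : ℂ :=
  (X * Ring.inverse (fisherOp f ρ) X).trace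

/-! ### Divisible evolutions and their generators -/

/-- Complete positivity: for every `k` the map `Φ ⊗ id_k`, which applies `Φ` to each of the
`k × k` blocks, preserves positive semidefiniteness. -/
def CompletelyPositive (Φ : SuperOp d) : Prop :=
  ∀ (k : ℕ) (X : Matrix (Fin k × Fin d) (Fin k × Fin d) ℂ), X.PosSemidef →
    (Matrix.of fun p q : Fin k × Fin d =>
      Φ (Matrix.of fun i j => X (p.1, i) (q.1, j)) p.2 q.2).PosSemidef

/-- A divisible evolution on the time axis `[0, ∞)`: completely positive maps `Φ t`, smooth in
`t`, with intermediate maps `Λ t s` such that `Φ t = Λ t s ∘ Φ s` for `s ≤ t`. The intermediate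
maps are not required to be positive. -/
structure IsDivisibleEvolution (Φ : ℝ → SuperOp d) (Λ : ℝ → ℝ → SuperOp d) : Prop where
  smooth : ∀ X i j, ContDiffOn ℝ ∞ (fun t => Φ t X i j) (Ici 0)
  completelyPositive : ∀ t, 0 ≤ t → CompletelyPositive (Φ t)
  divisible : ∀ s t, 0 ≤ s → s ≤ t → Φ t = Λ t s * Φ s

/-- `𝓛` is the generator at time `t`: the limit of `(Λ (t + ε) t - id) / ε` as `ε ↓ 0`. -/
def IsGeneratorAt (Λ : ℝ → ℝ → SuperOp d) (t : ℝ)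
    (𝓛 : Matrix (Fin d) (Fin d) ℂ → Matrix (Fin d) (Fin d) ℂ) : Prop :=
  ∀ X, Tendsto (fun ε : ℝ => (ε : ℂ)⁻¹ • (Λ (t + ε) t X - X)) (𝓝[>] 0) (𝓝 (𝓛 X))

/-- The GKLS expression with Hamiltonian `H`, rates `r α` and jump operators `A α`:
`-i [H, X] + ∑ α, r α (A α X (A α)† - ½ {(A α)† A α, X})`. -/
noncomputable def gkls {ι : Type*} [Fintype ι] (H : Matrix (Fin d) (Fin d) ℂ) (r : ι → ℝ)
    (A : ι → Matrix (Fin d) (Fin d) ℂ) (X : Matrix (Fin d) (Fin d) ℂ) :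
    Matrix (Fin d) (Fin d) ℂ :=
  -(Complex.I • ⁅H, X⁆) + ∑ α, (r α : ℂ) •
    (A α * X * (A α)ᴴ - (1 / 2 : ℂ) • ((A α)ᴴ * A α * X + X * ((A α)ᴴ * A α)))

/-! ### The Fisher information currents -/

/-- `B_s = (L_ρ + s R_ρ)⁻¹ [X]`. -/
noncomputable def bOp (ρ X : Matrix (Fin d) (Fin d) ℂ) (s : ℝ) : Matrix (Fin d) (Fin d) ℂ :=
  Ring.inverse (leftMul ρ + (s : ℂ) • rightMul ρ) X

/-- The integrand
`Tr (ρ [A, B_s†]† [A, B_s†]) + s Tr (ρ [A, B_s]† [A, B_s])` of the current. -/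
noncomputable def currentIntegrand (ρ X A : Matrix (Fin d) (Fin d) ℂ) (s : ℝ) : ℂ :=
  (ρ * (⁅A, (bOp ρ X s)ᴴ⁆ᴴ * ⁅A, (bOp ρ X s)ᴴ⁆)).trace
    + (s : ℂ) * (ρ * (⁅A, bOp ρ X s⁆ᴴ * ⁅A, bOp ρ X s⁆)).trace

/-- The Fisher information current of the jump operator `A` at `ρ` in the direction `X`, with
respect to the measure `N` on `[0, 1]`. -/
noncomputable def current (N : Measure ℝ) (ρ X A : Matrix (Fin d) (Fin d) ℂ) : ℂ :=
  -2 * ∫ s in Icc (0 : ℝ) 1, currentIntegrand ρ X A s ∂N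

end FisherFlow

namespace FisherFlow

variable {d : ℕ}

/-! ### Integrals over compact sets depending on a parameter -/

/-! The integral representation turns `1 / f` into the average over `N_g` of `1 / (x + s) + 1 / (1 +
s x)`. In an eigenbasis of `ρ` with eigenvalues `l`, the operator `J_f⁻¹` multiplies the `(j, k)`
entry by `1 / (l k * f (l j / l k))`, which is therefore the average of `1 / (l j + s l k) + 1 / (l
k + s l j)`. The two terms contribute equally to the trace, so `F = 2 ∫ Tr (X B_s) dN_g`
(`fisherInfo_eq_integral`), where `B_s` solves the linear equation `ρ B + s B ρ = X`.

The derivative in time needs no derivative of `B_s`. Pairing this equation at one time with its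
adjoint at another gives an exact formula for the increment of `Tr (X B_s)`, linear in the
increments of `X` and `ρ` (`trace_mul_bOp_sub`). Continuity of `B_s`, uniform in `s` by compactness,
is then enough. The result is `2 ∫ (Tr (X' (B + B†)) - Tr (ρ' (B B† + s B† B))) dN_g`.

For `X' = 𝓛 X` and `ρ' = 𝓛 ρ`, writing `X` as `ρ B + s B ρ` or as `B† ρ + s ρ B†` leaves two "carré
du champ" expressions of the generator (`trace_gkls`). In these the Hamiltonian part cancels, and
each jump operator contributes minus its rate times a trace of `ρ` against squared commutators. Such
a trace is nonnegative, whence the sign of the currents. -/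

theorem continuousOn_setIntegral_of_isCompact {X E : Type*} [TopologicalSpace X]
    [FirstCountableTopology X] [NormedAddCommGroup E] [NormedSpace ℝ E] {μ : Measure ℝ}
    [IsLocallyFiniteMeasure μ] {f : X → ℝ → E} {S : Set X} {K : Set ℝ} (hK : IsCompact K)
    (hf : ContinuousOn f.uncurry (S ×ˢ K)) :
    ContinuousOn (fun x => ∫ y in K, f x y ∂μ) S := by
  intro x₀ hx₀
  have hsec : ∀ x ∈ S, ContinuousOn (f x) K := fun x hx =>
    hf.comp (by fun_prop : ContinuousOn (fun y => (x, y)) K) fun y hy => ⟨hx, hy⟩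
  obtain ⟨M, hM⟩ := hK.bddAbove_image (hsec x₀ hx₀).norm
  -- Compactness of `K` keeps `f x` within distance `1` of `f x₀` on all of `K` for `x` near `x₀`;
  -- hence the constant dominating function `M + 1`.
  obtain ⟨v, hv, hvu⟩ := hK.mem_uniformity_of_prod hf hx₀ (Metric.dist_mem_uniformity one_pos)
  refine continuousWithinAt_of_dominated (bound := fun _ => M + 1) ?_ ?_ ?_ ?_
  · filter_upwards [self_mem_nhdsWithin] with x hx
    exact (hsec x hx).aestronglyMeasurable_of_isCompact hK hK.measurableSet
  · filter_upwards [hv] with x hx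
    filter_upwards [ae_restrict_mem hK.measurableSet] with y hy
    have h1 := hvu x hx y hy
    have h2 := hM (mem_image_of_mem _ hy)
    simp only [mem_ofPred_eq, dist_eq_norm] at h1 h2
    linarith [norm_le_norm_add_norm_sub' (f x y) (f x₀ y)]
  · exact integrableOn_const hK.measure_ne_top
  · filter_upwards [ae_restrict_mem hK.measurableSet] with y hy
    exact (hf (x₀, y) ⟨hx₀, hy⟩).comp (f := fun x => (x, y))
      (by fun_prop : Continuous fun x : X => (x, y)).continuousWithinAt fun x hx => ⟨hx, hy⟩

/-! ### The integral representation of the standard function -/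

/-- The kernel `1 / (x + s) + 1 / (1 + s x)` of the representation of `1 / f`. -/
noncomputable def symmKernel (x s : ℝ) : ℝ := (x + s)⁻¹ + (1 + s * x)⁻¹

theorem continuousOn_inv_add : ContinuousOn (Function.uncurry fun x s : ℝ => (x + s)⁻¹)
    (Ioi 0 ×ˢ Icc 0 1) := by
  refine ContinuousOn.inv₀ (by fun_prop) ?_
  rintro ⟨x, s⟩ ⟨hx, hs⟩
  simp only [mem_Ioi, mem_Icc] at *
  linarith [hs.1]

theorem continuousOn_inv_one_add_mul :
    ContinuousOn (Function.uncurry fun x s : ℝ => (1 + s * x)⁻¹) (Ioi 0 ×ˢ Icc 0 1) := by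
  refine ContinuousOn.inv₀ (by fun_prop) ?_
  rintro ⟨x, s⟩ ⟨hx, hs⟩
  have := mul_nonneg hs.1 (le_of_lt hx)
  simp only at *
  linarith

theorem integrableOn_section {f : ℝ → ℝ → ℝ} {S : Set ℝ} {μ : Measure ℝ} [IsFiniteMeasure μ]
    (hf : ContinuousOn f.uncurry (S ×ˢ Icc 0 1)) {x : ℝ} (hx : x ∈ S) :
    IntegrableOn (f x) (Icc 0 1) μ := by
  have h : ContinuousOn (fun y => f.uncurry (x, y)) (Icc 0 1) :=
    hf.comp (by fun_prop) fun _ hy => ⟨hx, hy⟩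
  exact h.integrableOn_compact isCompact_Icc

theorem integrableOn_symmKernel {μ : Measure ℝ} [IsFiniteMeasure μ] {x : ℝ} (hx : 0 < x) :
    IntegrableOn (symmKernel x) (Icc 0 1) μ :=
  (integrableOn_section continuousOn_inv_add hx).add
    (integrableOn_section continuousOn_inv_one_add_mul hx)

section Representation

variable {g : ℝ → ℝ} {ν₀ ν₁ : Measure ℝ}

theorem IsIntegralRepresentation.exists_eq (hν : IsIntegralRepresentation g ν₀ ν₁) :
    ∃ a : ℝ, ∀ x : ℝ, 0 < x → g x = a * (x - 1) + (x - 1) ^ 2 *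
      ((∫ s in Icc (0 : ℝ) 1, (x + s)⁻¹ ∂ν₀) + ∫ s in Icc (0 : ℝ) 1, (1 + s * x)⁻¹ ∂ν₁) := by
  obtain ⟨a, ha⟩ := hν
  refine ⟨a, fun x hx => ?_⟩
  rw [ha x hx]
  simp only [div_eq_mul_inv, integral_const_mul]
  ring

variable [IsFiniteMeasure ν₀] [IsFiniteMeasure ν₁]

theorem integral_symmKernel {x : ℝ} (hx : 0 < x) :
    ∫ s in Icc (0 : ℝ) 1, symmKernel x s ∂(ν₀ + ν₁) =
      (∫ s in Icc (0 : ℝ) 1, (x + s)⁻¹ ∂ν₀) + (∫ s in Icc (0 : ℝ) 1, (1 + s * x)⁻¹ ∂ν₁) +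
      ((∫ s in Icc (0 : ℝ) 1, (1 + s * x)⁻¹ ∂ν₀) + ∫ s in Icc (0 : ℝ) 1, (x + s)⁻¹ ∂ν₁) := by
  have h := fun (μ : Measure ℝ) [IsFiniteMeasure μ] =>
    integral_add (integrableOn_section (μ := μ) continuousOn_inv_add hx)
      (integrableOn_section (μ := μ) continuousOn_inv_one_add_mul hx)
  rw [Measure.restrict_add, integral_add_measure (integrableOn_symmKernel hx)
    (integrableOn_symmKernel hx)]
  simp only [symmKernel] at *
  rw [h ν₀, h ν₁]
  ring

/-- The transform `g x ↦ x g (x⁻¹)` reverses the sign of the linear term, which cancels, and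
exchanges the two kernels. Each of `ν₀`, `ν₁` thus meets both kernels, and only the sum of the
measures matters. -/
theorem IsIntegralRepresentation.add_mul_inv (hν : IsIntegralRepresentation g ν₀ ν₁) {x : ℝ}
    (hx : 0 < x) :
    g x + x * g x⁻¹ = (x - 1) ^ 2 * ∫ s in Icc (0 : ℝ) 1, symmKernel x s ∂(ν₀ + ν₁) := by
  obtain ⟨a, ha⟩ := hν.exists_eq
  have hx0 : x ≠ 0 := hx.ne'
  have h1 : ∀ s ∈ Icc (0 : ℝ) 1, (x⁻¹ + s)⁻¹ = x * (1 + s * x)⁻¹ := by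
    intro s hs
    have h1 : 1 + s * x ≠ 0 := by nlinarith [hs.1, mul_nonneg hs.1 hx.le]
    have h2 : x⁻¹ + s ≠ 0 := by have := inv_pos.2 hx; linarith [hs.1]
    have : x⁻¹ + s = (1 + s * x) * x⁻¹ := by field_simp
    rw [this, mul_inv, inv_inv, mul_comm]
  have h2 : ∀ s ∈ Icc (0 : ℝ) 1, (1 + s * x⁻¹)⁻¹ = x * (x + s)⁻¹ := by
    intro s hs
    have : 1 + s * x⁻¹ = (x + s) * x⁻¹ := by field_simp
    rw [this, mul_inv, inv_inv, mul_comm]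
  rw [ha x hx, ha x⁻¹ (inv_pos.2 hx), setIntegral_congr_fun measurableSet_Icc h1,
    setIntegral_congr_fun measurableSet_Icc h2, integral_symmKernel hx]
  simp only [integral_const_mul]
  field_simp
  ring

/-- The value at the removable singularity: comparison with the second-order Taylor expansion at `1`
shows that the factor `k` of `(x - 1) ^ 2` in `g` has `k 1 = g'' 1 / 2 = 1 / 2`, and the integral
here is `2 * k 1`. -/
theorem IsIntegralRepresentation.integral_symmKernel_one
    (hν : IsIntegralRepresentation g ν₀ ν₁) (hg : IsContrastFunction g) :
    ∫ s in Icc (0 : ℝ) 1, symmKernel 1 s ∂(ν₀ + ν₁) = 1 := by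
  obtain ⟨a, ha⟩ := hν.exists_eq
  set k : ℝ → ℝ := fun x =>
    (∫ s in Icc (0 : ℝ) 1, (x + s)⁻¹ ∂ν₀) + ∫ s in Icc (0 : ℝ) 1, (1 + s * x)⁻¹ ∂ν₁ with hk
  have hkc : Tendsto k (𝓝[≠] 1) (𝓝 (k 1)) := by
    have h := (continuousOn_setIntegral_of_isCompact (μ := ν₀) isCompact_Icc
      continuousOn_inv_add).add (continuousOn_setIntegral_of_isCompact (μ := ν₁) isCompact_Icc
      continuousOn_inv_one_add_mul)
    exact (h.continuousAt (Ioi_mem_nhds one_pos)).tendsto.mono_left nhdsWithin_le_nhds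
  have h1 : (1 : ℝ) ∈ Ioi (0 : ℝ) := mem_Ioi.2 one_pos
  have hT := Real.taylor_tendsto (n := 2) (convex_Ioi 0) h1
    (hg.smooth.of_le (WithTop.coe_le_coe.2 (le_top : (2 : ℕ∞) ≤ ⊤)))
  set b := iteratedDerivWithin 1 g (Ioi 0) 1
  have hE : ∀ x, taylorWithinEval g 2 (Ioi 0) 1 x = b * (x - 1) + (x - 1) ^ 2 / 2 := by
    intro x
    have h2 : iteratedDerivWithin 2 g (Ioi 0) 1 = 1 := by
      rw [iteratedDerivWithin_of_isOpen isOpen_Ioi h1, hg.normalised]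
    rw [taylorWithinEval_succ, taylorWithinEval_succ, taylor_within_zero_eval, hg.map_one, h2]
    simp [b]
    ring
  simp only [hE] at hT
  have hT' : Tendsto (fun x => (g x - (b * (x - 1) + (x - 1) ^ 2 / 2)) / (x - 1) ^ 2) (𝓝[≠] 1)
      (𝓝 0) := by
    rw [nhdsWithin_eq_nhds.2 (Ioi_mem_nhds one_pos)] at hT
    exact hT.mono_left nhdsWithin_le_nhds
  have hev : ∀ᶠ x in 𝓝[≠] (1 : ℝ), x ≠ 1 ∧ 0 < x :=
    (eventually_mem_nhdsWithin).and (nhdsWithin_le_nhds (Ioi_mem_nhds one_pos))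
  have hlin : Tendsto (fun x : ℝ => x - 1) (𝓝[≠] 1) (𝓝 0) := by
    have : Tendsto (fun x : ℝ => x - 1) (𝓝 1) (𝓝 (1 - 1)) := by
      exact (continuous_id.sub continuous_const).tendsto 1
    rw [sub_self] at this
    exact this.mono_left nhdsWithin_le_nhds
  -- The Taylor remainder divided by `x - 1`, less the vanishing term `(k x - 1 / 2) * (x - 1)`, is
  -- the constant `a - b`.
  have hab : a = b := by
    have h := (hT'.mul hlin).sub ((hkc.sub_const (1 / 2)).mul hlin)
    have h' : Tendsto (fun _ : ℝ => a - b) (𝓝[≠] 1) (𝓝 0) := by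
      refine (by simpa only [mul_zero, sub_zero] using h : Tendsto _ _ (𝓝 (0 : ℝ))).congr' ?_
      filter_upwards [hev] with x ⟨hx1, hx0⟩
      have : x - 1 ≠ 0 := sub_ne_zero.2 hx1
      rw [ha x hx0]
      simp only [hk]
      field_simp
      ring
    linarith [tendsto_nhds_unique h' tendsto_const_nhds]
  have hk1 : k 1 = 1 / 2 := by
    have h' : Tendsto k (𝓝[≠] 1) (𝓝 (0 + 1 / 2)) := by
      refine (hT'.add_const (1 / 2)).congr' ?_
      filter_upwards [hev] with x ⟨hx1, hx0⟩
      have : x - 1 ≠ 0 := sub_ne_zero.2 hx1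
      rw [ha x hx0, hab]
      simp only [hk]
      field_simp
      ring
    linarith [tendsto_nhds_unique hkc h']
  rw [integral_symmKernel one_pos]
  simp only [hk, mul_one, add_comm (1 : ℝ)] at hk1 ⊢
  linarith

/-- `1 / f` is the integral of the kernel `1 / (x + s) + 1 / (1 + s x)`. -/
theorem IsIntegralRepresentation.inv_standardFunction
    (hν : IsIntegralRepresentation g ν₀ ν₁) (hg : IsContrastFunction g) {x : ℝ} (hx : 0 < x) :
    (standardFunction g x)⁻¹ = ∫ s in Icc (0 : ℝ) 1, symmKernel x s ∂(ν₀ + ν₁) := by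
  unfold standardFunction
  split_ifs with h
  · rw [h, hν.integral_symmKernel_one hg, inv_one]
  · have : (x - 1) ^ 2 ≠ 0 := pow_ne_zero 2 (sub_ne_zero.2 h)
    rw [hν.add_mul_inv hx, inv_div, mul_div_cancel_left₀ _ this]

/-- With `0⁻¹ = 0`, a zero of `f` would make the integral of a strictly positive kernel vanish. Then
`N_g` would be null on `[0, 1]`, against the normalisation at `x = 1`. -/
theorem IsIntegralRepresentation.standardFunction_ne_zero
    (hν : IsIntegralRepresentation g ν₀ ν₁) (hg : IsContrastFunction g) {x : ℝ} (hx : 0 < x) :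
    standardFunction g x ≠ 0 := by
  intro h0
  have h := hν.inv_standardFunction hg hx
  rw [h0, inv_zero] at h
  have hpos : ∀ y : ℝ, 0 < y → ∀ s ∈ Icc (0 : ℝ) 1, 0 < symmKernel y s := by
    intro y hy s hs
    have h1 : 0 < y + s := by linarith [hs.1]
    have h2 : 0 < 1 + s * y := by nlinarith [mul_nonneg hs.1 hy.le]
    exact add_pos (inv_pos.2 h1) (inv_pos.2 h2)
  have hnn : ∀ y : ℝ, 0 < y → 0 ≤ᵐ[(ν₀ + ν₁).restrict (Icc 0 1)] symmKernel y := by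
    intro y hy
    filter_upwards [ae_restrict_mem measurableSet_Icc] with s hs using (hpos y hy s hs).le
  have hz := (integral_eq_zero_iff_of_nonneg_ae (hnn x hx) (integrableOn_symmKernel hx)).1 h.symm
  have hone := hν.integral_symmKernel_one hg
  have hF : ∀ᵐ s ∂(ν₀ + ν₁).restrict (Icc 0 1), False := by
    filter_upwards [hz, ae_restrict_mem measurableSet_Icc] with s h1 hs
    exact (hpos x hx s hs).ne' h1
  rw [integral_eq_zero_of_ae (hF.mono fun s hs => hs.elim)] at hone
  exact zero_ne_one hone

end Representation


/-! ### Superoperators diagonal in a basis of matrix units -/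

/-- The functional calculus of a Hermitian matrix acts on an eigenvector through the eigenvalue. -/
theorem cfc_mulVec_of_eigenvector {n : Type*} [Fintype n] [DecidableEq n] {M : Matrix n n ℂ}
    (hM : M.IsHermitian) (f : ℝ → ℝ) {v : n → ℂ} {c : ℝ} (hv : M *ᵥ v = (c : ℂ) • v) :
    cfc f M *ᵥ v = (f c : ℂ) • v := by
  by_cases hv0 : v = 0
  · simp [hv0]
  have hc : c ∈ spectrum ℝ M := by
    apply spectrum.of_algebraMap_mem ℂ
    rw [← Matrix.spectrum_toLin']
    exact (Module.End.hasEigenvalue_of_hasEigenvector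
      (Module.End.hasEigenvector_iff.2 ⟨Module.End.mem_eigenspace_iff.2 hv, hv0⟩)).mem_spectrum
  have hfin : (spectrum ℝ M).Finite := M.finite_real_spectrum
  -- The spectrum is finite, so an arbitrary `f` agrees on it with a polynomial, for which the claim
  -- reduces to powers of `M`.
  set p : Polynomial ℝ := Lagrange.interpolate hfin.toFinset id f
  have hp : ∀ x ∈ spectrum ℝ M, p.eval x = f x := fun x hx =>
    Lagrange.eval_interpolate_at_node f (v := id) (fun _ _ _ _ h => h) (hfin.mem_toFinset.2 hx)
  rw [cfc_congr fun x hx => (hp x hx).symm, cfc_polynomial p M hM.isSelfAdjoint, ← hp c hc]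
  have hpow : ∀ k : ℕ, M ^ k *ᵥ v = ((c : ℂ) ^ k) • v := by
    intro k
    induction k with
    | zero => simp
    | succ k ih => rw [pow_succ', ← Matrix.mulVec_mulVec, ih, Matrix.mulVec_smul, hv, smul_smul,
        pow_succ]
  rw [Polynomial.aeval_eq_sum_range, Matrix.sum_mulVec, Polynomial.eval_eq_sum_range]
  push_cast
  rw [Finset.sum_smul]
  refine Finset.sum_congr rfl fun k _ => ?_
  rw [Matrix.smul_mulVec, hpow, ← smul_smul]
  ext i
  simp

theorem superFun_apply_of_eigenvector {T : SuperOp d}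
    (hT : (LinearMap.toMatrix (Matrix.stdBasis ℂ (Fin d) (Fin d))
      (Matrix.stdBasis ℂ (Fin d) (Fin d)) T).IsHermitian) (f : ℝ → ℝ)
    {X : Matrix (Fin d) (Fin d) ℂ} {c : ℝ} (hX : T X = (c : ℂ) • X) :
    superFun f T X = (f c : ℂ) • X := by
  set b := Matrix.stdBasis ℂ (Fin d) (Fin d)
  have h := cfc_mulVec_of_eigenvector hT f (v := b.repr X) (c := c) (by
    rw [LinearMap.toMatrix_mulVec_repr, hX, map_smul]; rfl)
  apply b.repr.injective
  ext i
  have h2 := congrFun (LinearMap.toMatrix_mulVec_repr b b (superFun f T) X) i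
  rw [← h2, superFun, LinearMap.toMatrix_toLin, h, map_smul]
  rfl

/-- The superoperator multiplying the entries by `c j k`, in the basis given by `U`. -/
noncomputable def entrywiseMul (U V : Matrix (Fin d) (Fin d) ℂ) (c : Fin d → Fin d → ℂ) :
    SuperOp d where
  toFun X := U * Matrix.of (fun j k => c j k * (V * X * U) j k) * V
  map_add' X Y := by
    rw [← add_mul, ← mul_add]
    congr 2
    ext j k
    simp [mul_add, add_mul]
  map_smul' a X := by
    rw [RingHom.id_apply, ← smul_mul_assoc, ← mul_smul_comm]
    congr 2
    ext j k
    simp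
    ring

theorem entrywiseMul_mul {U V : Matrix (Fin d) (Fin d) ℂ} (hVU : V * U = 1)
    (c e : Fin d → Fin d → ℂ) :
    entrywiseMul U V c * entrywiseMul U V e = entrywiseMul U V fun j k => c j k * e j k := by
  ext1 X
  simp only [entrywiseMul, Module.End.mul_apply, LinearMap.coe_mk, AddHom.coe_mk]
  congr 2
  ext j k
  rw [show ∀ Z : Matrix (Fin d) (Fin d) ℂ, V * (U * Z * V) * U = Z by
    intro Z
    rw [mul_assoc U, ← mul_assoc V, hVU, one_mul, mul_assoc, hVU, mul_one]]
  simp [mul_assoc]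

theorem entrywiseMul_one {U V : Matrix (Fin d) (Fin d) ℂ} (hUV : U * V = 1) :
    entrywiseMul U V (fun _ _ => 1) = 1 := by
  ext1 X
  simp only [entrywiseMul, LinearMap.coe_mk, AddHom.coe_mk, one_mul, Module.End.one_apply]
  have : Matrix.of (fun j k => (V * X * U) j k) = V * X * U := rfl
  rw [this, ← mul_assoc, ← mul_assoc, hUV, one_mul, mul_assoc, hUV, mul_one]

theorem entrywiseMul_inv_mul {U V : Matrix (Fin d) (Fin d) ℂ} (hUV : U * V = 1)
    (hVU : V * U = 1) {c : Fin d → Fin d → ℂ} (hc : ∀ j k, c j k ≠ 0) :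
    entrywiseMul U V c * (entrywiseMul U V fun j k => (c j k)⁻¹) = 1 ∧
      (entrywiseMul U V fun j k => (c j k)⁻¹) * entrywiseMul U V c = 1 := by
  simp [entrywiseMul_mul hVU, hc, entrywiseMul_one hUV]

theorem isUnit_entrywiseMul {U V : Matrix (Fin d) (Fin d) ℂ} (hUV : U * V = 1)
    (hVU : V * U = 1) {c : Fin d → Fin d → ℂ} (hc : ∀ j k, c j k ≠ 0) :
    IsUnit (entrywiseMul U V c) :=
  have h := entrywiseMul_inv_mul hUV hVU hc
  ⟨⟨_, _, h.1, h.2⟩, rfl⟩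

theorem inverse_entrywiseMul {U V : Matrix (Fin d) (Fin d) ℂ} (hUV : U * V = 1)
    (hVU : V * U = 1) {c : Fin d → Fin d → ℂ} (hc : ∀ j k, c j k ≠ 0) :
    Ring.inverse (entrywiseMul U V c) = entrywiseMul U V fun j k => (c j k)⁻¹ :=
  have h := entrywiseMul_inv_mul hUV hVU hc
  Ring.inverse_unit (⟨_, _, h.1, h.2⟩ : (SuperOp d)ˣ)

theorem trace_mul_entrywiseMul (U V : Matrix (Fin d) (Fin d) ℂ) (c : Fin d → Fin d → ℂ)
    {X : Matrix (Fin d) (Fin d) ℂ} :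
    (X * entrywiseMul U V c X).trace =
      ∑ j, ∑ k, (V * X * U) j k * (V * X * U) k j * c j k := by
  have : (X * entrywiseMul U V c X).trace =
      ((V * X * U) * Matrix.of (fun j k => c j k * (V * X * U) j k)).trace := by
    simp only [entrywiseMul, LinearMap.coe_mk, AddHom.coe_mk]
    rw [← mul_assoc, Matrix.trace_mul_comm _ V]
    simp only [mul_assoc]
  rw [this, Matrix.trace, Finset.sum_comm]
  simp only [Matrix.diag_apply, Matrix.mul_apply (M := V * X * U), Matrix.of_apply]
  exact Finset.sum_congr rfl fun j _ => Finset.sum_congr rfl fun k _ => by ring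

/-- A superoperator that multiplies each `U E_jk V` by `c j k` is `entrywiseMul U V c`. -/
theorem eq_entrywiseMul {U V : Matrix (Fin d) (Fin d) ℂ} (hUV : U * V = 1)
    {c : Fin d → Fin d → ℂ} {S : SuperOp d}
    (hS : ∀ j k, S (U * Matrix.single j k 1 * V) = c j k • (U * Matrix.single j k 1 * V)) :
    S = entrywiseMul U V c := by
  ext1 X
  have hX : X = U * (V * X * U) * V := by
    rw [← mul_assoc, ← mul_assoc, hUV, one_mul, mul_assoc, hUV, mul_one]
  have hexp : ∀ Z : Matrix (Fin d) (Fin d) ℂ, U * Z * V =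
      ∑ j, ∑ k, Z j k • (U * Matrix.single j k 1 * V) := by
    intro Z
    conv_lhs => rw [Matrix.matrix_eq_sum_single Z]
    simp only [Finset.mul_sum, Finset.sum_mul]
    refine Finset.sum_congr rfl fun j _ => Finset.sum_congr rfl fun k _ => ?_
    rw [← smul_mul_assoc, ← mul_smul_comm, Matrix.smul_single, smul_eq_mul, mul_one]
  conv_lhs => rw [hX, hexp]
  simp only [map_sum, map_smul, hS]
  simp only [entrywiseMul, LinearMap.coe_mk, AddHom.coe_mk]
  rw [hexp]
  simp only [Matrix.of_apply, smul_smul, mul_comm]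

/-! ### Spectral form of the Fisher information -/

/-- `ρ = U diag(l) U†` with `U` unitary and `l` positive. -/
structure IsDiagonalization (ρ U : Matrix (Fin d) (Fin d) ℂ) (l : Fin d → ℝ) : Prop where
  mul_conjTranspose : U * Uᴴ = 1
  conjTranspose_mul : Uᴴ * U = 1
  pos : ∀ j, 0 < l j
  eq : ρ = U * Matrix.diagonal (fun j => (l j : ℂ)) * Uᴴ

theorem exists_isDiagonalization {ρ : Matrix (Fin d) (Fin d) ℂ} (hρ : ρ.PosDef) :
    ∃ U l, IsDiagonalization ρ U l := by
  refine ⟨hρ.1.eigenvectorUnitary, hρ.1.eigenvalues, Unitary.coe_mul_star_self _,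
    Unitary.coe_star_mul_self _, hρ.eigenvalues_pos, ?_⟩
  have := hρ.1.spectral_theorem
  rw [Unitary.conjStarAlgAut_apply] at this
  exact this

namespace IsDiagonalization

variable {ρ U : Matrix (Fin d) (Fin d) ℂ} {l : Fin d → ℝ}

theorem of_mul_single (c : Fin d → Fin d → ℂ) (j k : Fin d) :
    Matrix.of (fun a b => c a b * Matrix.single j k (1 : ℂ) a b) =
      c j k • Matrix.single j k 1 := by
  ext a b
  simp only [Matrix.of_apply, Matrix.smul_apply, Matrix.single_apply, smul_eq_mul]
  split_ifs with hab
  · rw [hab.1, hab.2]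
  · simp

theorem diagonal_mul_single (c : Fin d → ℂ) (j k : Fin d) :
    Matrix.diagonal c * Matrix.single j k 1 = c j • Matrix.single j k 1 := by
  rw [← of_mul_single (fun a _ => c a)]
  ext a b
  simp

theorem single_mul_diagonal (c : Fin d → ℂ) (j k : Fin d) :
    Matrix.single j k 1 * Matrix.diagonal c = c k • Matrix.single j k 1 := by
  rw [← of_mul_single (fun _ b => c b)]
  ext a b
  simp [mul_comm]

theorem leftMul_single (h : IsDiagonalization ρ U l) (j k : Fin d) :
    leftMul ρ (U * Matrix.single j k 1 * Uᴴ) = (l j : ℂ) • (U * Matrix.single j k 1 * Uᴴ) := by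
  rw [leftMul, LinearMap.mulLeft_apply, h.eq, ← mul_assoc, ← mul_assoc, mul_assoc _ Uᴴ U,
    h.conjTranspose_mul, mul_one, mul_assoc U, diagonal_mul_single, ← smul_mul_assoc,
    ← mul_smul_comm]

theorem rightMul_single (h : IsDiagonalization ρ U l) (j k : Fin d) :
    rightMul ρ (U * Matrix.single j k 1 * Uᴴ) = (l k : ℂ) • (U * Matrix.single j k 1 * Uᴴ) := by
  rw [rightMul, LinearMap.mulRight_apply, h.eq, ← mul_assoc, ← mul_assoc, mul_assoc _ Uᴴ U,
    h.conjTranspose_mul, mul_one, mul_assoc U, single_mul_diagonal, ← smul_mul_assoc,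
    ← mul_smul_comm]

theorem entrywiseMul_single (h : IsDiagonalization ρ U l) (c : Fin d → Fin d → ℂ) (j k : Fin d) :
    entrywiseMul U Uᴴ c (U * Matrix.single j k 1 * Uᴴ) =
      c j k • (U * Matrix.single j k 1 * Uᴴ) := by
  have h1 : Uᴴ * (U * Matrix.single j k 1 * Uᴴ) * U = Matrix.single j k 1 := by
    rw [mul_assoc U, ← mul_assoc Uᴴ, h.conjTranspose_mul, one_mul, mul_assoc, h.conjTranspose_mul,
      mul_one]
  simp only [entrywiseMul, LinearMap.coe_mk, AddHom.coe_mk]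
  rw [h1, of_mul_single, mul_smul_comm, smul_mul_assoc]

theorem rightMul_eq (h : IsDiagonalization ρ U l) :
    rightMul ρ = entrywiseMul U Uᴴ fun _ k => (l k : ℂ) :=
  eq_entrywiseMul h.mul_conjTranspose h.rightMul_single

theorem leftMul_eq (h : IsDiagonalization ρ U l) :
    leftMul ρ = entrywiseMul U Uᴴ fun j _ => (l j : ℂ) :=
  eq_entrywiseMul h.mul_conjTranspose h.leftMul_single

theorem leftMul_add_smul_rightMul_eq (h : IsDiagonalization ρ U l) (s : ℝ) :
    leftMul ρ + (s : ℂ) • rightMul ρ = entrywiseMul U Uᴴ fun j k => ((l j + s * l k : ℝ) : ℂ) := by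
  refine eq_entrywiseMul h.mul_conjTranspose fun j k => ?_
  rw [LinearMap.add_apply, LinearMap.smul_apply, h.leftMul_single, h.rightMul_single, smul_smul,
    ← add_smul]
  push_cast
  rfl

theorem add_mul_ne_zero (h : IsDiagonalization ρ U l) {s : ℝ} (hs : 0 ≤ s) (j k : Fin d) :
    ((l j + s * l k : ℝ) : ℂ) ≠ 0 :=
  Complex.ofReal_ne_zero.2 (add_pos_of_pos_of_nonneg (h.pos j) (mul_nonneg hs (h.pos k).le)).ne'

theorem bOp_eq (h : IsDiagonalization ρ U l) {s : ℝ} (hs : 0 ≤ s) (X : Matrix (Fin d) (Fin d) ℂ) :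
    bOp ρ X s = entrywiseMul U Uᴴ (fun j k => ((l j + s * l k : ℝ) : ℂ)⁻¹) X := by
  rw [bOp, h.leftMul_add_smul_rightMul_eq, inverse_entrywiseMul h.mul_conjTranspose
    h.conjTranspose_mul (h.add_mul_ne_zero hs)]

theorem modularOp_eq (h : IsDiagonalization ρ U l) :
    leftMul ρ * Ring.inverse (rightMul ρ) =
      entrywiseMul U Uᴴ fun j k => ((l j / l k : ℝ) : ℂ) := by
  rw [h.leftMul_eq, h.rightMul_eq, inverse_entrywiseMul h.mul_conjTranspose h.conjTranspose_mul
    fun _ k => Complex.ofReal_ne_zero.2 (h.pos k).ne', entrywiseMul_mul h.conjTranspose_mul]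
  simp [div_eq_mul_inv]

end IsDiagonalization

/-- Real multipliers give a Hilbert-Schmidt self-adjoint superoperator. This ensures that `cfc` in
`superFun` acts on the modular operator as a genuine functional calculus, not through its default
value. -/
theorem isHermitian_toMatrix_entrywiseMul (U : Matrix (Fin d) (Fin d) ℂ) (c : Fin d → Fin d → ℝ) :
    (LinearMap.toMatrix (Matrix.stdBasis ℂ (Fin d) (Fin d)) (Matrix.stdBasis ℂ (Fin d) (Fin d))
      (entrywiseMul U Uᴴ fun j k => (c j k : ℂ))).IsHermitian := by
  have key : ∀ p q : Fin d × Fin d,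
      LinearMap.toMatrix (Matrix.stdBasis ℂ (Fin d) (Fin d)) (Matrix.stdBasis ℂ (Fin d) (Fin d))
        (entrywiseMul U Uᴴ fun j k => (c j k : ℂ)) p q =
      ∑ k, ∑ j, U p.1 j * star (U q.1 j) * c j k * (star (U p.2 k) * U q.2 k) := by
    rintro ⟨p₁, p₂⟩ ⟨q₁, q₂⟩
    have h1 : ∀ j k, (Uᴴ * Matrix.single q₁ q₂ (1 : ℂ) * U) j k = star (U q₁ j) * U q₂ k := by
      intro j k
      rw [Matrix.mul_apply, Finset.sum_eq_single q₂]
      · simp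
      · intro b _ hb
        rw [Matrix.mul_single_apply_of_ne _ _ _ _ _ hb, zero_mul]
      · simp
    rw [LinearMap.toMatrix_apply, Matrix.stdBasis_eq_single]
    change (entrywiseMul U Uᴴ (fun j k => (c j k : ℂ)) (Matrix.single q₁ q₂ 1)) p₁ p₂ = _
    simp only [entrywiseMul, LinearMap.coe_mk, AddHom.coe_mk, h1]
    simp only [Matrix.mul_apply, Matrix.of_apply, Finset.sum_mul, Matrix.conjTranspose_apply]
    exact Finset.sum_congr rfl fun k _ => Finset.sum_congr rfl fun j _ => by ring
  ext p q
  rw [Matrix.conjTranspose_apply, key, key, star_sum]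
  refine Finset.sum_congr rfl fun k _ => ?_
  rw [star_sum]
  refine Finset.sum_congr rfl fun j _ => ?_
  simp only [star_mul', Complex.star_def, Complex.conj_ofReal, Complex.conj_conj]
  ring

theorem IsDiagonalization.fisherOp_eq {ρ U : Matrix (Fin d) (Fin d) ℂ} {l : Fin d → ℝ}
    (h : IsDiagonalization ρ U l) (f : ℝ → ℝ) :
    fisherOp f ρ = entrywiseMul U Uᴴ fun j k => ((l k * f (l j / l k) : ℝ) : ℂ) := by
  refine eq_entrywiseMul h.mul_conjTranspose fun j k => ?_
  rw [fisherOp, h.modularOp_eq, Module.End.mul_apply,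
    superFun_apply_of_eigenvector (isHermitian_toMatrix_entrywiseMul U _) f
      (h.entrywiseMul_single _ j k), map_smul, h.rightMul_single, smul_smul]
  push_cast
  rw [mul_comm]

/-- The Fisher information as an integral over the measure of the representation of `g`. -/
theorem fisherInfo_eq_integral {g : ℝ → ℝ} (hg : IsContrastFunction g) {ν₀ ν₁ : Measure ℝ}
    [IsFiniteMeasure ν₀] [IsFiniteMeasure ν₁] (hν : IsIntegralRepresentation g ν₀ ν₁)
    {ρ : Matrix (Fin d) (Fin d) ℂ} (hρ : ρ.PosDef) (X : Matrix (Fin d) (Fin d) ℂ) :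
    fisherInfo (standardFunction g) ρ X =
      2 * ∫ s in Icc (0 : ℝ) 1, (X * bOp ρ X s).trace ∂(ν₀ + ν₁) := by
  obtain ⟨U, l, h⟩ := exists_isDiagonalization hρ
  have hf : ∀ j k, ((l k * standardFunction g (l j / l k) : ℝ) : ℂ) ≠ 0 := fun j k =>
    Complex.ofReal_ne_zero.2 (mul_ne_zero (h.pos k).ne'
      (hν.standardFunction_ne_zero hg (div_pos (h.pos j) (h.pos k))))
  have hcont : ∀ j k, ContinuousOn (fun s : ℝ => ((l j + s * l k : ℝ) : ℂ)⁻¹) (Icc 0 1) :=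
    fun j k => ContinuousOn.inv₀ (by fun_prop) fun s hs => h.add_mul_ne_zero hs.1 j k
  have hint : ∀ j k, IntegrableOn (fun s : ℝ => ((l j + s * l k : ℝ) : ℂ)⁻¹) (Icc 0 1)
      (ν₀ + ν₁) := fun j k => (hcont j k).integrableOn_compact isCompact_Icc
  -- The factor `1 / l k` clears the denominators of the kernel at `x = l j / l k`.
  have hcoef : ∀ j k, ((l k * standardFunction g (l j / l k) : ℝ) : ℂ)⁻¹ =
      (∫ s in Icc (0 : ℝ) 1, ((l j + s * l k : ℝ) : ℂ)⁻¹ ∂(ν₀ + ν₁)) +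
        ∫ s in Icc (0 : ℝ) 1, ((l k + s * l j : ℝ) : ℂ)⁻¹ ∂(ν₀ + ν₁) := by
    intro j k
    rw [← integral_add (hint j k) (hint k j), ← Complex.ofReal_inv, mul_inv,
      hν.inv_standardFunction hg (div_pos (h.pos j) (h.pos k)), ← integral_const_mul,
      ← integral_complex_ofReal]
    refine setIntegral_congr_fun measurableSet_Icc fun s hs => ?_
    have h1 : l k ≠ 0 := (h.pos k).ne'
    have e1 : l k * (l j / l k + s) = l j + s * l k := by field_simp
    have e2 : l k * (1 + s * (l j / l k)) = l k + s * l j := by field_simp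
    simp only [symmKernel]
    rw [mul_add, ← mul_inv, ← mul_inv, e1, e2]
    push_cast
    rfl
  rw [fisherInfo, h.fisherOp_eq, inverse_entrywiseMul h.mul_conjTranspose h.conjTranspose_mul hf,
    trace_mul_entrywiseMul]
  have hB : ∫ s in Icc (0 : ℝ) 1, (X * bOp ρ X s).trace ∂(ν₀ + ν₁) =
      ∑ j, ∑ k, (Uᴴ * X * U) j k * (Uᴴ * X * U) k j *
        ∫ s in Icc (0 : ℝ) 1, ((l j + s * l k : ℝ) : ℂ)⁻¹ ∂(ν₀ + ν₁) := by
    rw [setIntegral_congr_fun measurableSet_Icc (g := fun s =>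
      ∑ j, ∑ k, (Uᴴ * X * U) j k * (Uᴴ * X * U) k j * ((l j + s * l k : ℝ) : ℂ)⁻¹)
      fun s hs => by simp only [h.bOp_eq hs.1, trace_mul_entrywiseMul]]
    rw [integral_finsetSum _ fun j _ => integrable_finsetSum _ fun k _ =>
      (hint j k).const_mul _]
    refine Finset.sum_congr rfl fun j _ => ?_
    rw [integral_finsetSum _ fun k _ => (hint j k).const_mul _]
    exact Finset.sum_congr rfl fun k _ => integral_const_mul _ _
  rw [hB]
  simp only [hcoef, mul_add, Finset.sum_add_distrib]
  rw [two_mul]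
  congr 1
  -- The weight `(U† X U)_jk (U† X U)_kj` is symmetric, so exchanging `j` and `k` identifies the two
  -- halves.
  rw [Finset.sum_comm]
  exact Finset.sum_congr rfl fun j _ => Finset.sum_congr rfl fun k _ => by ring

/-! ### The operators `B_s` -/

theorem isUnit_leftMul_add_smul_rightMul {ρ : Matrix (Fin d) (Fin d) ℂ} (hρ : ρ.PosDef) {s : ℝ}
    (hs : 0 ≤ s) : IsUnit (leftMul ρ + (s : ℂ) • rightMul ρ) := by
  obtain ⟨U, l, h⟩ := exists_isDiagonalization hρ
  rw [h.leftMul_add_smul_rightMul_eq]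
  exact isUnit_entrywiseMul h.mul_conjTranspose h.conjTranspose_mul (h.add_mul_ne_zero hs)

theorem mul_bOp_add {ρ : Matrix (Fin d) (Fin d) ℂ} (hρ : ρ.PosDef) (X : Matrix (Fin d) (Fin d) ℂ)
    {s : ℝ} (hs : 0 ≤ s) : ρ * bOp ρ X s + (s : ℂ) • (bOp ρ X s * ρ) = X := by
  have h := congrArg (fun T : SuperOp d => T X)
    (Ring.mul_inverse_cancel _ (isUnit_leftMul_add_smul_rightMul hρ hs))
  simpa [Module.End.mul_apply, leftMul, rightMul, bOp] using h

theorem conjTranspose_bOp_mul_add {ρ X : Matrix (Fin d) (Fin d) ℂ} (hρ : ρ.PosDef)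
    (hX : X.IsHermitian) {s : ℝ} (hs : 0 ≤ s) :
    (bOp ρ X s)ᴴ * ρ + (s : ℂ) • (ρ * (bOp ρ X s)ᴴ) = X := by
  have h := congrArg Matrix.conjTranspose (mul_bOp_add hρ X hs)
  simpa [Matrix.conjTranspose_add, Matrix.conjTranspose_smul, Matrix.conjTranspose_mul,
    hρ.1.eq, hX.eq] using h

theorem continuousOn_inverse_apply {P : Type*} [TopologicalSpace P] {S : Set P} {T : P → SuperOp d}
    {X : P → Matrix (Fin d) (Fin d) ℂ} (hT : ∀ Z, ContinuousOn (fun p => T p Z) S)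
    (hu : ∀ p ∈ S, IsUnit (T p)) (hX : ContinuousOn X S) :
    ContinuousOn (fun p => Ring.inverse (T p) (X p)) S := by
  set b := Matrix.stdBasis ℂ (Fin d) (Fin d)
  have hrepr : Continuous fun Z => (b.repr Z : Fin d × Fin d → ℂ) :=
    LinearMap.continuous_of_finiteDimensional b.equivFun.toLinearMap
  have hM : ContinuousOn (fun p => LinearMap.toMatrix b b (T p)) S := by
    refine continuousOn_pi.2 fun i => continuousOn_pi.2 fun j => ?_
    simp only [LinearMap.toMatrix_apply]
    exact (continuous_apply i).comp_continuousOn (hrepr.comp_continuousOn (hT (b j)))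
  have hdet : ∀ p ∈ S, (LinearMap.toMatrix b b (T p)).det ≠ 0 := fun p hp => by
    rw [LinearMap.det_toMatrix]
    exact ((hu p hp).map LinearMap.det).ne_zero
  -- Cramer's rule: adjugate and determinant are polynomial in the entries.
  have hinv : ContinuousOn (fun p => (LinearMap.toMatrix b b (T p))⁻¹) S := by
    simp only [Matrix.inv_def, Ring.inverse_eq_inv']
    have hd : ContinuousOn (fun p => (LinearMap.toMatrix b b (T p)).det) S :=
      (Continuous.matrix_det continuous_id).comp_continuousOn hM
    have ha : ContinuousOn (fun p => (LinearMap.toMatrix b b (T p)).adjugate) S :=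
      (Continuous.matrix_adjugate continuous_id).comp_continuousOn hM
    exact (hd.inv₀ hdet).smul ha
  have hvec : ContinuousOn (fun p => (LinearMap.toMatrix b b (T p))⁻¹ *ᵥ b.repr (X p)) S := by
    refine continuousOn_pi.2 fun i => ?_
    have h1 : ∀ j, ContinuousOn (fun p => (LinearMap.toMatrix b b (T p))⁻¹ i j) S :=
      continuousOn_pi.1 (continuousOn_pi.1 hinv i)
    have h2 : ∀ j, ContinuousOn (fun p => b.repr (X p) j) S :=
      continuousOn_pi.1 (hrepr.comp_continuousOn hX)
    exact continuousOn_finsetSum _ fun j _ => (h1 j).mul (h2 j)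
  refine ((LinearMap.continuous_of_finiteDimensional
    b.equivFun.symm.toLinearMap).comp_continuousOn hvec).congr fun p hp => ?_
  have h1 : (LinearMap.toMatrix b b (T p))⁻¹ = LinearMap.toMatrix b b (Ring.inverse (T p)) := by
    refine Matrix.inv_eq_right_inv ?_
    rw [← LinearMap.toMatrix_mul, Ring.mul_inverse_cancel _ (hu p hp), LinearMap.toMatrix_one]
  rw [Function.comp_apply, h1, LinearMap.toMatrix_mulVec_repr]
  exact (b.equivFun.symm_apply_apply _).symm

theorem continuousOn_bOp {S : Set ℝ} {ρ X : ℝ → Matrix (Fin d) (Fin d) ℂ}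
    (hρ : ContinuousOn ρ S) (hX : ContinuousOn X S) (hpos : ∀ τ ∈ S, (ρ τ).PosDef) :
    ContinuousOn (Function.uncurry fun τ s => bOp (ρ τ) (X τ) s) (S ×ˢ Icc 0 1) := by
  have h1 : ContinuousOn (fun p : ℝ × ℝ => ρ p.1) (S ×ˢ Icc 0 1) :=
    hρ.comp continuousOn_fst fun p hp => hp.1
  refine continuousOn_inverse_apply (fun Z => ?_)
    (fun p hp => isUnit_leftMul_add_smul_rightMul (hpos _ hp.1) hp.2.1)
    (hX.comp continuousOn_fst fun p hp => hp.1)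
  exact (h1.mul continuousOn_const).add
    ((Complex.continuous_ofReal.comp_continuousOn continuousOn_snd).smul
      (continuousOn_const.mul h1))

/-! ### The action of a GKLS generator -/

/-- The dissipator of the jump operator `A`. -/
noncomputable def dissipator (A X : Matrix (Fin d) (Fin d) ℂ) : Matrix (Fin d) (Fin d) ℂ :=
  A * X * Aᴴ - (1 / 2 : ℂ) • (Aᴴ * A * X + X * (Aᴴ * A))

theorem trace_commutator (H ρ B C : Matrix (Fin d) (Fin d) ℂ) :
    (B * ⁅H, C * ρ⁆).trace + (C * ⁅H, ρ * B⁆).trace - (⁅H, ρ⁆ * (B * C)).trace = 0 := by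
  have h1 := Matrix.trace_mul_comm (B * H * C) ρ
  have h2 := Matrix.trace_mul_comm (B * C) (ρ * H)
  have h3 := Matrix.trace_mul_comm (C * H) (ρ * B)
  have h4 := Matrix.trace_mul_comm C (ρ * B * H)
  have h5 := Matrix.trace_mul_comm H (ρ * B * C)
  simp only [Ring.lie_def, mul_sub, sub_mul, Matrix.trace_sub, mul_assoc] at *
  linear_combination h1 - h2 + h3 - h4 - h5

/-- The carré du champ of the dissipator, by cyclicity of the trace alone: all terms containing `Aᴴ
* A` uninterrupted by `B`, `C` or `ρ` on one side combine into the product of commutators. For `C =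
Bᴴ` the first commutator is the adjoint of the second. -/
theorem trace_dissipator (A ρ B C : Matrix (Fin d) (Fin d) ℂ) :
    (B * dissipator A (C * ρ)).trace + (C * dissipator A (ρ * B)).trace -
      (dissipator A ρ * (B * C)).trace =
    -(ρ * ((B * Aᴴ - Aᴴ * B) * (A * C - C * A))).trace := by
  have h1 := Matrix.trace_mul_comm (B * A * C) (ρ * Aᴴ)
  have h2 := Matrix.trace_mul_comm (B * Aᴴ * A * C) ρ
  have h3 := Matrix.trace_mul_comm (B * C) (ρ * Aᴴ * A)
  have h4 := Matrix.trace_mul_comm (C * A) (ρ * B * Aᴴ)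
  have h5 := Matrix.trace_mul_comm (C * Aᴴ * A) (ρ * B)
  have h6 := Matrix.trace_mul_comm C (ρ * B * Aᴴ * A)
  have h7 := Matrix.trace_mul_comm A (ρ * Aᴴ * B * C)
  have h8 := Matrix.trace_mul_comm (Aᴴ * A) (ρ * B * C)
  simp only [dissipator, mul_sub, sub_mul, mul_add, add_mul, smul_mul_assoc, mul_smul_comm,
    Matrix.trace_sub, Matrix.trace_add, Matrix.trace_smul, smul_eq_mul, mul_assoc] at *
  linear_combination h1 - 1 / 2 * h2 - 1 / 2 * h3 + h4 - 1 / 2 * h5 - 1 / 2 * h6 - h7 + 1 / 2 * h8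

section Gkls

variable {ι : Type*} [Fintype ι]

theorem gkls_eq (H : Matrix (Fin d) (Fin d) ℂ) (r : ι → ℝ) (A : ι → Matrix (Fin d) (Fin d) ℂ)
    (X : Matrix (Fin d) (Fin d) ℂ) :
    gkls H r A X = -(Complex.I • ⁅H, X⁆) + ∑ α, (r α : ℂ) • dissipator (A α) X := rfl

theorem gkls_add (H : Matrix (Fin d) (Fin d) ℂ) (r : ι → ℝ) (A : ι → Matrix (Fin d) (Fin d) ℂ)
    (X Y : Matrix (Fin d) (Fin d) ℂ) : gkls H r A (X + Y) = gkls H r A X + gkls H r A Y := by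
  simp only [gkls_eq, dissipator, Ring.lie_def, mul_add, add_mul, smul_add, smul_sub,
    Finset.sum_add_distrib, Finset.sum_sub_distrib]
  abel

theorem gkls_smul (H : Matrix (Fin d) (Fin d) ℂ) (r : ι → ℝ) (A : ι → Matrix (Fin d) (Fin d) ℂ)
    (c : ℂ) (X : Matrix (Fin d) (Fin d) ℂ) : gkls H r A (c • X) = c • gkls H r A X := by
  simp only [gkls_eq, dissipator, Ring.lie_def, mul_smul_comm, smul_mul_assoc, smul_add, smul_sub,
    smul_neg, Finset.smul_sum, smul_comm c]

theorem trace_gkls (H : Matrix (Fin d) (Fin d) ℂ) (r : ι → ℝ) (A : ι → Matrix (Fin d) (Fin d) ℂ)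
    (ρ B C : Matrix (Fin d) (Fin d) ℂ) :
    (B * gkls H r A (C * ρ)).trace + (C * gkls H r A (ρ * B)).trace -
      (gkls H r A ρ * (B * C)).trace =
    -∑ α, (r α : ℂ) * (ρ * ((B * (A α)ᴴ - (A α)ᴴ * B) * (A α * C - C * A α))).trace := by
  simp only [gkls_eq, mul_add, add_mul, mul_neg, neg_mul, Finset.mul_sum, Finset.sum_mul,
    smul_mul_assoc, mul_smul_comm, Matrix.trace_add, Matrix.trace_neg, Matrix.trace_sum,
    Matrix.trace_smul, smul_eq_mul]
  have h : ∀ α, (r α : ℂ) * (ρ * ((B * (A α)ᴴ - (A α)ᴴ * B) * (A α * C - C * A α))).trace =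
      (r α : ℂ) * (dissipator (A α) ρ * (B * C)).trace -
      (r α : ℂ) * (B * dissipator (A α) (C * ρ)).trace -
      (r α : ℂ) * (C * dissipator (A α) (ρ * B)).trace := fun α => by
    linear_combination (r α : ℂ) * trace_dissipator (A α) ρ B C
  simp only [h, Finset.sum_sub_distrib]
  linear_combination (-Complex.I) * trace_commutator H ρ B C

/-- Against `B` the matrix `X` is expanded by the adjoint equation, against `B†` by the original
one. The terms then group into `trace_gkls` for `(B, B†)` plus `s` times `trace_gkls` for `(B†, B)`.
-/
theorem trace_gkls_eq_sum_currentIntegrand (H : Matrix (Fin d) (Fin d) ℂ) (r : ι → ℝ)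
    (A : ι → Matrix (Fin d) (Fin d) ℂ) {ρ X : Matrix (Fin d) (Fin d) ℂ} (hρ : ρ.PosDef)
    (hX : X.IsHermitian) {s : ℝ} (hs : 0 ≤ s) :
    (gkls H r A X * (bOp ρ X s + (bOp ρ X s)ᴴ)).trace -
      (gkls H r A ρ * (bOp ρ X s * (bOp ρ X s)ᴴ + (s : ℂ) • ((bOp ρ X s)ᴴ * bOp ρ X s))).trace =
    -∑ α, (r α : ℂ) * currentIntegrand ρ X (A α) s := by
  have hB := mul_bOp_add hρ X hs
  have hC := conjTranspose_bOp_mul_add hρ hX hs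
  simp only [currentIntegrand]
  set B := bOp ρ X s
  set C := Bᴴ with hCdef
  have hCH : Cᴴ = B := Matrix.conjTranspose_conjTranspose B
  have h1 : (gkls H r A X * B).trace =
      (B * gkls H r A (C * ρ)).trace + s * (B * gkls H r A (ρ * C)).trace := by
    rw [Matrix.trace_mul_comm, ← hC, gkls_add, gkls_smul, mul_add, Matrix.trace_add,
      mul_smul_comm, Matrix.trace_smul, smul_eq_mul]
  have h2 : (gkls H r A X * C).trace =
      (C * gkls H r A (ρ * B)).trace + s * (C * gkls H r A (B * ρ)).trace := by
    rw [Matrix.trace_mul_comm, ← hB, gkls_add, gkls_smul, mul_add, Matrix.trace_add,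
      mul_smul_comm, Matrix.trace_smul, smul_eq_mul]
  have h3 := trace_gkls H r A ρ B C
  have h4 := trace_gkls H r A ρ C B
  rw [mul_add, Matrix.trace_add, h1, h2, mul_add, Matrix.trace_add, mul_smul_comm,
    Matrix.trace_smul, smul_eq_mul]
  simp only [Ring.lie_def, Matrix.conjTranspose_sub, Matrix.conjTranspose_mul, hCH, ← hCdef,
    mul_add, Finset.sum_add_distrib, mul_left_comm _ (s : ℂ), ← Finset.mul_sum]
  linear_combination h3 + s * h4

end Gkls

theorem currentIntegrand_nonneg {ρ : Matrix (Fin d) (Fin d) ℂ} (hρ : ρ.PosSemidef)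
    (X A : Matrix (Fin d) (Fin d) ℂ) {s : ℝ} (hs : 0 ≤ s) : 0 ≤ currentIntegrand ρ X A s := by
  have h : ∀ Y : Matrix (Fin d) (Fin d) ℂ, 0 ≤ (ρ * (Yᴴ * Y)).trace := fun Y => by
    rw [← mul_assoc, Matrix.trace_mul_comm, ← mul_assoc]
    exact (hρ.mul_mul_conjTranspose_same Y).trace_nonneg
  exact add_nonneg (h _) (mul_nonneg (Complex.zero_le_real.2 hs) (h _))

theorem integrableOn_currentIntegrand {ρ : Matrix (Fin d) (Fin d) ℂ} (hρ : ρ.PosDef)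
    (X A : Matrix (Fin d) (Fin d) ℂ) {N : Measure ℝ} [IsFiniteMeasure N] :
    IntegrableOn (currentIntegrand ρ X A) (Icc 0 1) N := by
  have hB : ContinuousOn (fun s => bOp ρ X s) (Icc 0 1) := by
    have h := continuousOn_bOp (S := univ) (ρ := fun _ => ρ) (X := fun _ => X) continuousOn_const
      continuousOn_const fun _ _ => hρ
    exact h.comp (f := fun s => ((0 : ℝ), s)) (by fun_prop) fun s hs => ⟨mem_univ _, hs⟩
  refine ContinuousOn.integrableOn_compact isCompact_Icc ?_
  have hBH : ContinuousOn (fun s => (bOp ρ X s)ᴴ) (Icc 0 1) :=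
    (Continuous.matrix_conjTranspose continuous_id).comp_continuousOn hB
  have htr : ∀ {B C : ℝ → Matrix (Fin d) (Fin d) ℂ}, ContinuousOn B (Icc 0 1) →
      ContinuousOn C (Icc 0 1) → ContinuousOn
        (fun s => (ρ * ((B s * Aᴴ - Aᴴ * B s) * (A * C s - C s * A))).trace) (Icc 0 1) := by
    intro B C hB hC
    exact (Continuous.matrix_trace continuous_id).comp_continuousOn (by fun_prop)
  have heq : currentIntegrand ρ X A = fun s =>
      (ρ * ((bOp ρ X s * Aᴴ - Aᴴ * bOp ρ X s) * (A * (bOp ρ X s)ᴴ - (bOp ρ X s)ᴴ * A))).trace +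
      (s : ℂ) * (ρ * (((bOp ρ X s)ᴴ * Aᴴ - Aᴴ * (bOp ρ X s)ᴴ) *
        (A * bOp ρ X s - bOp ρ X s * A))).trace := by
    ext s
    simp only [currentIntegrand, Ring.lie_def, Matrix.conjTranspose_sub, Matrix.conjTranspose_mul,
      Matrix.conjTranspose_conjTranspose]
  rw [heq]
  exact (htr hB hBH).add
    (Complex.continuous_ofReal.continuousOn.mul (htr hBH hB))

theorem current_nonpos {ρ : Matrix (Fin d) (Fin d) ℂ} (hρ : ρ.PosSemidef)
    (X A : Matrix (Fin d) (Fin d) ℂ) (N : Measure ℝ) : current N ρ X A ≤ 0 := by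
  have h : 0 ≤ ∫ s in Icc (0 : ℝ) 1, currentIntegrand ρ X A s ∂N := by
    refine integral_nonneg_of_ae ?_
    filter_upwards [ae_restrict_mem measurableSet_Icc] with s hs
    exact currentIntegrand_nonneg hρ X A hs.1
  rw [current, neg_mul]
  exact neg_nonpos.2 (mul_nonneg zero_le_two h)

/-! ### Completely positive maps and differentiability of the evolution -/

theorem CompletelyPositive.map_posSemidef {Φ : SuperOp d} (hΦ : CompletelyPositive Φ)
    {X : Matrix (Fin d) (Fin d) ℂ} (hX : X.PosSemidef) : (Φ X).PosSemidef :=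
  (hΦ 1 (X.submatrix Prod.snd Prod.snd) (hX.submatrix _)).submatrix fun i : Fin d => (0, i)

/-- Polarisation: `4 X = (X + 1)² - (X - 1)²` is a difference of positive semidefinite matrices. -/
theorem CompletelyPositive.map_isHermitian {Φ : SuperOp d} (hΦ : CompletelyPositive Φ)
    {X : Matrix (Fin d) (Fin d) ℂ} (hX : X.IsHermitian) : (Φ X).IsHermitian := by
  have hsq : ∀ Y : Matrix (Fin d) (Fin d) ℂ, Y.IsHermitian → (Φ (Y * Y)).IsHermitian := by
    intro Y hY
    have h := Matrix.posSemidef_conjTranspose_mul_self Y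
    rw [hY.eq] at h
    exact (hΦ.map_posSemidef h).1
  have h1 := hsq (X + 1) (hX.add Matrix.isHermitian_one)
  have h2 := hsq (X - 1) (hX.sub Matrix.isHermitian_one)
  have hexp : (X + 1) * (X + 1) - (X - 1) * (X - 1) = (4 : ℝ) • X := by
    rw [show (4 : ℝ) • X = X + X + X + X by module]
    noncomm_ring
  have h3 : Φ X = (4 : ℝ)⁻¹ • (Φ ((X + 1) * (X + 1)) - Φ ((X - 1) * (X - 1))) := by
    rw [← map_sub, hexp, LinearMap.map_smul_of_tower, smul_smul]
    norm_num
  rw [h3, Matrix.IsHermitian, Matrix.conjTranspose_smul, (h1.sub h2).eq, star_trivial]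

namespace IsDivisibleEvolution

variable {Φ : ℝ → SuperOp d} {Λ : ℝ → ℝ → SuperOp d}

theorem continuousOn (hΦ : IsDivisibleEvolution Φ Λ) (X : Matrix (Fin d) (Fin d) ℂ) :
    ContinuousOn (fun τ => Φ τ X) (Ici 0) :=
  continuousOn_pi.2 fun i => continuousOn_pi.2 fun j => (hΦ.smooth X i j).continuousOn

theorem hasDerivWithinAt (hΦ : IsDivisibleEvolution Φ Λ) {t : ℝ} (ht : 0 ≤ t)
    {𝓛 : Matrix (Fin d) (Fin d) ℂ → Matrix (Fin d) (Fin d) ℂ} (hL : IsGeneratorAt Λ t 𝓛)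
    (X : Matrix (Fin d) (Fin d) ℂ) (i j : Fin d) :
    HasDerivWithinAt (fun τ => Φ τ X i j) (𝓛 (Φ t X) i j) (Ici 0) t := by
  have hdiff := ((hΦ.smooth X i j).differentiableOn (by simp) t ht).hasDerivWithinAt
  have h1 := (hasDerivWithinAt_iff_tendsto_slope' self_notMem_Ioi).1
    (hdiff.mono fun τ hτ => ht.trans (le_of_lt hτ))
  have hadd : Tendsto (fun ε : ℝ => t + ε) (𝓝[>] 0) (𝓝[>] t) := by
    refine tendsto_nhdsWithin_iff.2 ⟨?_, ?_⟩
    · have : Tendsto (fun ε : ℝ => t + ε) (𝓝 0) (𝓝 (t + 0)) :=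
        (continuous_const.add continuous_id).tendsto 0
      rw [add_zero] at this
      exact this.mono_left nhdsWithin_le_nhds
    · filter_upwards [self_mem_nhdsWithin] with ε hε
      exact lt_add_of_pos_right t hε
  have h2 := ((continuous_apply j).comp (continuous_apply i)).continuousAt.tendsto.comp
    (hL (Φ t X))
  -- Smoothness supplies the derivative within `[0, ∞)`; the generator is a right-hand limit and
  -- only has to identify its value. By divisibility its quotients are the slopes of `Φ` at `t`.
  have h3 := tendsto_nhds_unique (h2.congr' ?_) (h1.comp hadd)
  · rw [← h3] at hdiff
    exact hdiff
  · filter_upwards [self_mem_nhdsWithin] with ε hε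
    have hdiv : Λ (t + ε) t (Φ t X) = Φ (t + ε) X := by
      rw [hΦ.divisible t (t + ε) ht (le_add_of_nonneg_right (le_of_lt hε)), Module.End.mul_apply]
    rw [Function.comp_apply, Function.comp_apply, hdiv, slope, add_sub_cancel_left, vsub_eq_sub,
      ← Complex.coe_smul, Complex.ofReal_inv]
    rfl

/-- Since `Φ τ π` stays positive semidefinite, positive definiteness amounts to a nonzero
determinant, an open condition. -/
theorem eventually_posDef (hΦ : IsDivisibleEvolution Φ Λ) {π : Matrix (Fin d) (Fin d) ℂ}
    (hπ : π.PosSemidef) {t : ℝ} (ht : 0 ≤ t) (hπt : (Φ t π).PosDef) :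
    {τ | 0 ≤ τ ∧ (Φ τ π).PosDef} ∈ 𝓝[Ici 0] t := by
  have hdet : ContinuousOn (fun τ => (Φ τ π).det) (Ici 0) :=
    (Continuous.matrix_det continuous_id).comp_continuousOn (hΦ.continuousOn π)
  have h0 : (Φ t π).det ≠ 0 := hπt.posSemidef.posDef_iff_det_ne_zero.1 hπt
  filter_upwards [self_mem_nhdsWithin, (hdet t ht).eventually_ne h0] with τ hτ h
  exact ⟨hτ, ((hΦ.completelyPositive τ hτ).map_posSemidef hπ).posDef_iff_det_ne_zero.2 h⟩

end IsDivisibleEvolution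

/-! ### Differentiation under the integral sign -/

/-- The first factor vanishes at `t`, so the slope is that of `y` times `k τ`, and `k` need only be
continuous. -/
theorem hasDerivWithinAt_sub_mul {y k : ℝ → ℂ} {y' : ℂ} {S : Set ℝ} {t : ℝ}
    (hy : HasDerivWithinAt y y' S t) (hk : ContinuousWithinAt k S t) :
    HasDerivWithinAt (fun τ => (y τ - y t) * k τ) (y' * k t) S t := by
  rw [hasDerivWithinAt_iff_tendsto_slope] at hy ⊢
  refine (hy.mul (hk.mono_left (nhdsWithin_mono t sdiff_subset))).congr fun τ => ?_
  simp [slope, mul_assoc]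

/-- `Y` does not depend on `s`: entry by entry it leaves the integral, and the integrals of `K` are
continuous in `τ`. -/
theorem hasDerivWithinAt_integral_trace_sub_mul {μ : Measure ℝ} [IsFiniteMeasure μ]
    {Y : ℝ → Matrix (Fin d) (Fin d) ℂ} {Y' : Matrix (Fin d) (Fin d) ℂ}
    {K : ℝ → ℝ → Matrix (Fin d) (Fin d) ℂ} {S : Set ℝ} {t : ℝ} (ht : t ∈ S)
    (hY : ∀ i j, HasDerivWithinAt (fun τ => Y τ i j) (Y' i j) S t)
    (hK : ContinuousOn K.uncurry (S ×ˢ Icc 0 1)) :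
    HasDerivWithinAt (fun τ => ∫ s in Icc (0 : ℝ) 1, ((Y τ - Y t) * K τ s).trace ∂μ)
      (∫ s in Icc (0 : ℝ) 1, (Y' * K t s).trace ∂μ) S t := by
  have hKij : ∀ i j, ContinuousOn (Function.uncurry fun τ s => K τ s i j) (S ×ˢ Icc 0 1) :=
    fun i j => continuousOn_pi.1 (continuousOn_pi.1 hK i) j
  have hint : ∀ τ ∈ S, ∀ i j, IntegrableOn (fun s => K τ s i j) (Icc 0 1) μ :=
    fun τ hτ i j => ((hKij i j).comp (f := fun s => (τ, s)) (by fun_prop)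
      fun s hs => ⟨hτ, hs⟩).integrableOn_compact isCompact_Icc
  have hexp : ∀ τ ∈ S, ∀ Z : Matrix (Fin d) (Fin d) ℂ,
      ∫ s in Icc (0 : ℝ) 1, (Z * K τ s).trace ∂μ =
        ∑ i, ∑ j, Z i j * ∫ s in Icc (0 : ℝ) 1, K τ s j i ∂μ := by
    intro τ hτ Z
    simp only [Matrix.trace, Matrix.diag_apply, Matrix.mul_apply]
    refine (integral_finsetSum _ fun i _ => integrable_finsetSum _ fun j _ =>
      (hint τ hτ j i).const_mul _).trans ?_
    refine Finset.sum_congr rfl fun i _ => ?_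
    refine (integral_finsetSum _ fun j _ => (hint τ hτ j i).const_mul _).trans ?_
    exact Finset.sum_congr rfl fun j _ => integral_const_mul _ _
  rw [hexp t ht]
  refine HasDerivWithinAt.congr_of_mem ?_ (fun τ hτ => hexp τ hτ _) ht
  refine HasDerivWithinAt.fun_sum fun i _ => HasDerivWithinAt.fun_sum fun j _ => ?_
  exact hasDerivWithinAt_sub_mul (hY i j)
    (continuousOn_setIntegral_of_isCompact isCompact_Icc (hKij j i) t ht)

/-- A resolvent-type identity. With `C = B₀†`, expanding `X₀ = C ρ₀ + s ρ₀ C` gives `Tr (X₀ B) = Tr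
(C (ρ₀ B + s B ρ₀))`, and the bracket is `X` minus the contribution of `ρ - ρ₀`; likewise `Tr (X₀ C)
= Tr (X₀ B₀)`. -/
theorem trace_mul_bOp_sub {ρ₀ X₀ ρ X : Matrix (Fin d) (Fin d) ℂ} (hρ₀ : ρ₀.PosDef)
    (hX₀ : X₀.IsHermitian) (hρ : ρ.PosDef) {s : ℝ} (hs : 0 ≤ s) :
    (X * bOp ρ X s).trace = ((X - X₀) * (bOp ρ X s + (bOp ρ₀ X₀ s)ᴴ)).trace -
      ((ρ - ρ₀) * (bOp ρ X s * (bOp ρ₀ X₀ s)ᴴ + (s : ℂ) • ((bOp ρ₀ X₀ s)ᴴ * bOp ρ X s))).trace +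
      (X₀ * bOp ρ₀ X₀ s).trace := by
  have hB := mul_bOp_add hρ X hs
  have hB₀ := mul_bOp_add hρ₀ X₀ hs
  have hC := conjTranspose_bOp_mul_add hρ₀ hX₀ hs
  set B := bOp ρ X s
  set B₀ := bOp ρ₀ X₀ s
  set C := B₀ᴴ
  have e1 := congrArg (fun Z => (C * Z).trace) hB
  have e2 := congrArg (fun Z => (C * Z).trace) hB₀
  have e3 := congrArg (fun Z => (Z * B).trace) hC
  have e4 := congrArg (fun Z => (Z * B₀).trace) hC
  have c1 := Matrix.trace_mul_comm C X
  have c2 := Matrix.trace_mul_comm C X₀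
  have c3 := Matrix.trace_mul_comm C (ρ * B)
  have c4 := Matrix.trace_mul_comm (C * B) ρ
  have c5 := Matrix.trace_mul_comm C (ρ₀ * B)
  have c8 := Matrix.trace_mul_comm (C * B₀) ρ₀
  simp only [mul_add, add_mul, sub_mul, smul_mul_assoc, mul_smul_comm, Matrix.trace_add,
    Matrix.trace_sub, Matrix.trace_smul, smul_eq_mul, mul_assoc] at *
  linear_combination e1 + c1 - c3 - s * c4 - e3 + c5 + e4 - e2 + s * c8 - c2

/-- The derivative of the Fisher information along a curve of positive definite matrices. -/
theorem hasDerivWithinAt_fisherInfo {g : ℝ → ℝ} (hg : IsContrastFunction g) {ν₀ ν₁ : Measure ℝ}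
    [IsFiniteMeasure ν₀] [IsFiniteMeasure ν₁] (hν : IsIntegralRepresentation g ν₀ ν₁)
    {S : Set ℝ} {t : ℝ} (ht : t ∈ S) {ρ X : ℝ → Matrix (Fin d) (Fin d) ℂ}
    {ρ' X' : Matrix (Fin d) (Fin d) ℂ} (hpos : ∀ τ ∈ S, (ρ τ).PosDef) (hX : (X t).IsHermitian)
    (hρc : ContinuousOn ρ S) (hXc : ContinuousOn X S)
    (hρ' : ∀ i j, HasDerivWithinAt (fun τ => ρ τ i j) (ρ' i j) S t)
    (hX' : ∀ i j, HasDerivWithinAt (fun τ => X τ i j) (X' i j) S t) :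
    HasDerivWithinAt (fun τ => fisherInfo (standardFunction g) (ρ τ) (X τ))
      (2 * ∫ s in Icc (0 : ℝ) 1, ((X' * (bOp (ρ t) (X t) s + (bOp (ρ t) (X t) s)ᴴ)).trace -
        (ρ' * (bOp (ρ t) (X t) s * (bOp (ρ t) (X t) s)ᴴ +
          (s : ℂ) • ((bOp (ρ t) (X t) s)ᴴ * bOp (ρ t) (X t) s))).trace) ∂(ν₀ + ν₁)) S t := by
  set B : ℝ → ℝ → Matrix (Fin d) (Fin d) ℂ := fun τ s => bOp (ρ τ) (X τ) s
  have hB : ContinuousOn B.uncurry (S ×ˢ Icc 0 1) :=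
    continuousOn_bOp hρc hXc hpos
  have hC : ContinuousOn (fun p : ℝ × ℝ => (B t p.2)ᴴ) (S ×ˢ Icc 0 1) :=
    (Continuous.matrix_conjTranspose continuous_id).comp_continuousOn
      (hB.comp (f := fun p : ℝ × ℝ => (t, p.2)) (by fun_prop) fun p hp => ⟨ht, hp.2⟩)
  set K₁ : ℝ → ℝ → Matrix (Fin d) (Fin d) ℂ := fun τ s => B τ s + (B t s)ᴴ
  set K₂ : ℝ → ℝ → Matrix (Fin d) (Fin d) ℂ := fun τ s =>
    B τ s * (B t s)ᴴ + (s : ℂ) • ((B t s)ᴴ * B τ s)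
  have hK₁ : ContinuousOn K₁.uncurry (S ×ˢ Icc 0 1) := hB.add hC
  have hK₂ : ContinuousOn K₂.uncurry (S ×ˢ Icc 0 1) :=
    (hB.mul hC).add ((Complex.continuous_ofReal.comp_continuousOn continuousOn_snd).smul
      (hC.mul hB))
  have hint : ∀ {K : ℝ → ℝ → Matrix (Fin d) (Fin d) ℂ} {τ : ℝ} (Z : Matrix (Fin d) (Fin d) ℂ),
      ContinuousOn K.uncurry (S ×ˢ Icc 0 1) → τ ∈ S →
      IntegrableOn (fun s => (Z * K τ s).trace) (Icc 0 1) (ν₀ + ν₁) := by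
    intro K τ Z hK hτ
    have h : ContinuousOn (fun s => K.uncurry (τ, s)) (Icc 0 1) :=
      hK.comp (by fun_prop) fun s hs => ⟨hτ, hs⟩
    exact ((Continuous.matrix_trace continuous_id).comp_continuousOn
      (continuousOn_const.mul h)).integrableOn_compact isCompact_Icc
  have h := (((hasDerivWithinAt_integral_trace_sub_mul (μ := ν₀ + ν₁) ht hX' hK₁).sub
    (hasDerivWithinAt_integral_trace_sub_mul (μ := ν₀ + ν₁) ht hρ' hK₂)).add_const
    (∫ s in Icc (0 : ℝ) 1, (X t * B t s).trace ∂(ν₀ + ν₁))).const_mul 2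
  rw [integral_sub (hint X' hK₁ ht) (hint ρ' hK₂ ht)]
  refine h.congr_of_mem (fun τ hτ => ?_) ht
  rw [fisherInfo_eq_integral hg hν (hpos τ hτ)]
  congr 1
  simp only [Pi.sub_apply]
  rw [← integral_sub (hint _ hK₁ hτ) (hint _ hK₂ hτ)]
  refine Eq.trans ?_
    (integral_add ((hint _ hK₁ hτ).sub (hint _ hK₂ hτ)) (hint (K := B) _ hB ht))
  exact setIntegral_congr_fun measurableSet_Icc fun s hs =>
    trace_mul_bOp_sub (hpos t ht) hX (hpos τ hτ) hs.1

end FisherFlow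

theorem mainTheorem4 {d : ℕ} {ι : Type*} [Fintype ι]
    (g : ℝ → ℝ) (hg : FisherFlow.IsContrastFunction g)
    (ν₀ ν₁ : MeasureTheory.Measure ℝ)
    [MeasureTheory.IsFiniteMeasure ν₀] [MeasureTheory.IsFiniteMeasure ν₁]
    (hν : FisherFlow.IsIntegralRepresentation g ν₀ ν₁)
    (Φ : ℝ → FisherFlow.SuperOp d) (Λ : ℝ → ℝ → FisherFlow.SuperOp d)
    (hΦ : FisherFlow.IsDivisibleEvolution Φ Λ)
    (H : ℝ → Matrix (Fin d) (Fin d) ℂ) (r : ι → ℝ → ℝ)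
    (A : ι → ℝ → Matrix (Fin d) (Fin d) ℂ)
    (hH : ∀ t, 0 ≤ t → (H t).IsHermitian)
    (hL : ∀ t, 0 ≤ t →
      FisherFlow.IsGeneratorAt Λ t (FisherFlow.gkls (H t) (fun α => r α t) (fun α => A α t)))
    (π δρ : Matrix (Fin d) (Fin d) ℂ)
    (hπ : π.PosSemidef) (hπ1 : π.trace = 1)
    (hδ : δρ.IsHermitian) (hδ0 : δρ.trace = 0)
    (t : ℝ) (ht : 0 ≤ t) (hπt : (Φ t π).PosDef) :
    HasDerivWithinAt
        (fun τ : ℝ =>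
          FisherFlow.fisherInfo (FisherFlow.standardFunction g) (Φ τ π) (Φ τ δρ))
        (∑ α, (r α t : ℂ) * FisherFlow.current (ν₀ + ν₁) (Φ t π) (Φ t δρ) (A α t))
        (Set.Ici 0) t ∧
      ∀ α,
        MeasureTheory.IntegrableOn
          (FisherFlow.currentIntegrand (Φ t π) (Φ t δρ) (A α t)) (Set.Icc 0 1) (ν₀ + ν₁) ∧
        (∀ s ∈ Set.Icc (0 : ℝ) 1,
          0 ≤ FisherFlow.currentIntegrand (Φ t π) (Φ t δρ) (A α t) s) ∧
        FisherFlow.current (ν₀ + ν₁) (Φ t π) (Φ t δρ) (A α t) ≤ 0 := by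
  have hN : ∀ α, IntegrableOn (FisherFlow.currentIntegrand (Φ t π) (Φ t δρ) (A α t)) (Icc 0 1)
      (ν₀ + ν₁) := fun α => FisherFlow.integrableOn_currentIntegrand hπt _ _
  have hXt : (Φ t δρ).IsHermitian := (hΦ.completelyPositive t ht).map_isHermitian hδ
  refine ⟨?_, fun α => ⟨hN α,
    fun s hs => FisherFlow.currentIntegrand_nonneg hπt.posSemidef _ _ hs.1,
    FisherFlow.current_nonpos hπt.posSemidef _ _ _⟩⟩
  -- The derivative is taken within the times at which `π_τ` is positive definite; these form a
  -- neighbourhood of `t` within `[0, ∞)`.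
  set S : Set ℝ := {τ | 0 ≤ τ ∧ (Φ τ π).PosDef}
  have hS : S ⊆ Ici 0 := fun τ hτ => hτ.1
  have h := FisherFlow.hasDerivWithinAt_fisherInfo hg hν (S := S) ⟨ht, hπt⟩ (fun τ hτ => hτ.2) hXt
    ((hΦ.continuousOn π).mono hS) ((hΦ.continuousOn δρ).mono hS)
    (fun i j => (hΦ.hasDerivWithinAt ht (hL t ht) π i j).mono hS)
    (fun i j => (hΦ.hasDerivWithinAt ht (hL t ht) δρ i j).mono hS)
  rw [setIntegral_congr_fun measurableSet_Icc fun s hs =>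
    FisherFlow.trace_gkls_eq_sum_currentIntegrand (H t) (fun α => r α t) (fun α => A α t) hπt hXt
      hs.1, integral_neg, integral_finsetSum _ fun α _ => (hN α).const_mul _, mul_neg, ← neg_mul,
    Finset.mul_sum] at h
  have hsum : ∑ α, (r α t : ℂ) * FisherFlow.current (ν₀ + ν₁) (Φ t π) (Φ t δρ) (A α t) =
      ∑ α, -2 * ∫ s in Icc (0 : ℝ) 1,
        (r α t : ℂ) * FisherFlow.currentIntegrand (Φ t π) (Φ t δρ) (A α t) s ∂(ν₀ + ν₁) := by
    refine Finset.sum_congr rfl fun α _ => ?_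
    rw [integral_const_mul, FisherFlow.current]
    ring
  rw [hsum]
  exact h.mono_of_mem_nhdsWithin (hΦ.eventually_posDef hπ ht hπt)
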